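/- Write $\mathbb{D}=\{z\in\mathbb{C}:|z|<1\}$; "univalent" means analytic and injective in $\mathbb{D}$, "convex univalent" means univalent with convex image, and $u\prec v$ means $u=v\circ w$ in $\mathbb{D}$ for some analytic $w:\mathbb{D}\to\mathbb{D}$ with $w(0)=0$. Let $\mathcal{A}$ be the class of analytic $f$ in $\mathbb{D}$ with $f(0)=0$, $f'(0)=1$, and $\mathcal{H}[1,1]$ the class of analytic $p$ in $\mathbb{D}$ with $p(0)=1$. Let $\mathcal{Q}$ be the class of functions $p$ that extend to be analytic and injective on $\overline{\mathbb{D}}\setminus E(p)$, where $E(p)=\{\zeta\in\partial\mathbb{D}:\lim_{z\to\zeta}p(z)=\infty\}$, with $p'(\zeta)\neq0$ for $\zeta\in\partial\mathbb{D}\setminus E(p)$. **Theorem 5.** Let $\alpha\neq0$ be a complex number, and let $q_1,q_2$ be convex univalent in $\mathbb{D}$ with $q_1(0)=q_2(0)=1$ and $$\operatorname{Re}\Big(\frac{1-\alpha}{\alpha}+2q_i(z)\Big)>0\qquad(i=1,2;\ z\in\mathbb{D}).$$ Set $h_i(z)=\alpha q_i(z)^2+(1-\alpha)q_i(z)+\alpha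 zq_i'(z)$. (a) Let $f\in\mathcal{A}$ and let $\Phi$ be analytic in a domain containing $f(\mathbb{D})$, with $\Phi(0)=0$, $\Phi'(0)=1$ and $\Phi(w)\neq0$ for $w\in f(\mathbb{D})\setminus\{0\}$. Suppose that $\dfrac{zf'(z)}{\Phi(f(z))}\in\mathcal{H}[1,1]\cap\mathcal{Q}$ and that $$\Psi_f(z)=\frac{zf'(z)}{\Phi(f(z))}\left(1+\frac{\alpha zf''(z)}{f'(z)}+\frac{\alpha z\big(f'(z)-(\Phi\circ f)'(z)\big)}{\Phi(f(z))}\right)$$ is univalent in $\mathbb{D}$ (both functions being understood with their removable singularities, at $0$ and at zeros of $f'$, filled in). Then $$h_1\prec\Psi_f\prec h_2\quad\text{implies}\quad q_1(z)\prec\frac{zf'(z)}{\Phi(f(z))}\prec q_2(z).$$ (b) $q_1$ is the best subordinant of the differential superordination $h_1(z)\prec\alpha p(z)^2+(1-\alpha)p(z)+\alpha zp'(z)$: it is univalent, it satisfies $q_1\prec p$ for every solution $p$, and every analytic $q$ in $\mathbb{D}$ with $q\prec p$ for every solution $p$ satisfies $q\prec q_1$. Here a solution is a univalent $p\in\mathcal{H}[1,1]$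 for which the right-hand side is univalent and the superordination holds. (c) $q_2$ is the best dominant of the differential subordination $\alpha p(z)^2+(1-\alpha)p(z)+\alpha zp'(z)\prec h_2(z)$: it is univalent, it satisfies $p\prec q_2$ for every $p\in\mathcal{H}[1,1]$ that satisfies the subordination, and $q_2\prec q$ for every univalent $q$ such that $p\prec q$ for all those $p$. -/

import Mathlib

open Set Filter Topology

namespace PhiLike

/-- The open unit disk of the complex plane. -/
def disk : Set ℂ := Metric.ball (0 : ℂ) 1

/-- The class `H[a, n]`: analytic functions on the disk of the form `a + a_n z^n + ...`. -/
def ClassH (a : ℂ) (n : ℕ) : Set (ℂ → ℂ) :=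
  {f | AnalyticOnNhd ℂ f disk ∧ f 0 = a ∧ ∀ k, 0 < k → k < n → iteratedDeriv k f 0 = 0}

/-- The class `A` of normalized analytic functions: `f 0 = 0` and `f' 0 = 1`. -/
def ClassA : Set (ℂ → ℂ) :=
  {f | AnalyticOnNhd ℂ f disk ∧ f 0 = 0 ∧ deriv f 0 = 1}

/-- Analytic and injective in the disk. -/
def Univalent (f : ℂ → ℂ) : Prop := AnalyticOnNhd ℂ f disk ∧ InjOn f disk

/-- Univalent in the disk with convex image. -/
def ConvexUnivalent (f : ℂ → ℂ) : Prop := Univalent f ∧ Convex ℝ (f '' disk)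

/-- `f` is subordinate to `g`: `f = g ∘ w` in the disk for some Schwarz function `w`. -/
def Subordinate (f g : ℂ → ℂ) : Prop :=
  ∃ w : ℂ → ℂ, AnalyticOnNhd ℂ w disk ∧ w 0 = 0 ∧ (∀ z ∈ disk, ‖w z‖ < 1) ∧
    ∀ z ∈ disk, f z = g (w z)

/-- The exceptional set `E(f)` of boundary points at which `f` tends to infinity
(from inside the disk). -/
def exceptionalSet (f : ℂ → ℂ) : Set ℂ :=
  {ζ | ‖ζ‖ = 1 ∧ Tendsto f (𝓝[disk] ζ) (Bornology.cobounded ℂ)}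

/-- The class `Q`: functions `f` on the disk that are (that is, extend to be) analytic and
injective on the closed disk minus `E(f)`, the derivative of the extension having no zero on the
unit circle minus `E(f)`. -/
def ClassQ : Set (ℂ → ℂ) :=
  {f | ∃ F : ℂ → ℂ, EqOn F f disk ∧
      AnalyticOnNhd ℂ F (Metric.closedBall (0 : ℂ) 1 \ exceptionalSet f) ∧
      InjOn F (Metric.closedBall (0 : ℂ) 1 \ exceptionalSet f) ∧
      ∀ ζ ∈ Metric.sphere (0 : ℂ) 1 \ exceptionalSet f, deriv F ζ ≠ 0}

/-- The function `z ↦ φ (p z, z p' z, z² p'' z; z)`. -/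
noncomputable def diffOp (φ : ℂ → ℂ → ℂ → ℂ → ℂ) (p : ℂ → ℂ) (z : ℂ) : ℂ :=
  φ (p z) (z * deriv p z) (z ^ 2 * deriv (deriv p) z) z

/-- `p ∈ H[a, 1]` is a solution of the differential superordination
`h ≺ φ (p, z p', z² p''; z)`: both `p` and the right-hand side are univalent. -/
def IsSuperSolution (φ : ℂ → ℂ → ℂ → ℂ → ℂ) (a : ℂ) (h p : ℂ → ℂ) : Prop :=
  p ∈ ClassH a 1 ∧ Univalent p ∧ Univalent (diffOp φ p) ∧ Subordinate h (diffOp φ p)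

/-- `q` is a subordinant of the differential superordination. -/
def IsSubordinant (φ : ℂ → ℂ → ℂ → ℂ → ℂ) (a : ℂ) (h q : ℂ → ℂ) : Prop :=
  AnalyticOnNhd ℂ q disk ∧ ∀ p, IsSuperSolution φ a h p → Subordinate q p

/-- `q` is the best subordinant: a univalent subordinant that superordinates all subordinants. -/
def IsBestSubordinant (φ : ℂ → ℂ → ℂ → ℂ → ℂ) (a : ℂ) (h q : ℂ → ℂ) : Prop :=
  Univalent q ∧ IsSubordinant φ a h q ∧ ∀ r, IsSubordinant φ a h r → Subordinate r q

/-- `p ∈ H[a, 1]` is a solution of the differential subordination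
`φ (p, z p', z² p''; z) ≺ h`. -/
def IsSubSolution (φ : ℂ → ℂ → ℂ → ℂ → ℂ) (a : ℂ) (h p : ℂ → ℂ) : Prop :=
  p ∈ ClassH a 1 ∧ AnalyticOnNhd ℂ (diffOp φ p) disk ∧ Subordinate (diffOp φ p) h

/-- `q` is a (univalent) dominant of the differential subordination. -/
def IsDominant (φ : ℂ → ℂ → ℂ → ℂ → ℂ) (a : ℂ) (h q : ℂ → ℂ) : Prop :=
  Univalent q ∧ ∀ p, IsSubSolution φ a h p → Subordinate p q

/-- `q` is the best dominant: a dominant subordinate to all dominants. -/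
def IsBestDominant (φ : ℂ → ℂ → ℂ → ℂ → ℂ) (a : ℂ) (h q : ℂ → ℂ) : Prop :=
  IsDominant φ a h q ∧ ∀ r, IsDominant φ a h r → Subordinate q r

/-- `h = α q² + (1 - α) q + α z q'`. -/
noncomputable def hFun (α : ℂ) (q : ℂ → ℂ) (z : ℂ) : ℂ :=
  α * q z ^ 2 + (1 - α) * q z + α * z * deriv q z

/-- Admissible `Φ` for `f`: analytic in a domain containing the image of the disk under `f`, with
`Φ 0 = 0`, `Φ' 0 = 1`, and without zeros in that image except `0`. -/
def AdmissiblePhi (f Φ : ℂ → ℂ) : Prop :=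
  (∃ U : Set ℂ, IsOpen U ∧ IsConnected U ∧ f '' disk ⊆ U ∧ AnalyticOnNhd ℂ Φ U) ∧
    Φ 0 = 0 ∧ deriv Φ 0 = 1 ∧ ∀ w ∈ f '' disk \ {0}, Φ w ≠ 0

open Classical in
/-- `z f' / Φ(f)`, with its removable singularity at `0` filled in: for `f ∈ A`, `Φ 0 = 0` and
`Φ' 0 = 1` the limit at `0` is `1`. -/
noncomputable def phiQuot (f Φ : ℂ → ℂ) (z : ℂ) : ℂ :=
  if z = 0 then 1 else z * deriv f z / Φ (f z)

open Classical in
/-- The function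
`(z f' / Φ(f)) * (1 + α z f'' / f' + α z (f' - (Φ ∘ f)') / Φ(f))`
with its removable singularities filled in: the limit at `0` is `1`, and at the (isolated) zeros
of `f'` the factor `f'` is cancelled in the product `(z f' / Φ(f)) * (α z f'' / f')`. -/
noncomputable def phiExpr (α : ℂ) (f Φ : ℂ → ℂ) (z : ℂ) : ℂ :=
  if z = 0 then 1 else
    z * deriv f z / Φ (f z) + α * z ^ 2 * deriv (deriv f) z / Φ (f z) +
      z * deriv f z / Φ (f z) *
        (α * z * (deriv f z - deriv (fun u => Φ (f u)) z) / Φ (f z))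

/-- Away from the removable singularities `phiExpr` is the product displayed above. -/
theorem phiExpr_eq (α : ℂ) (f Φ : ℂ → ℂ) (z : ℂ) (hz : z ≠ 0) (hf : deriv f z ≠ 0) :
    phiExpr α f Φ z = z * deriv f z / Φ (f z) *
      (1 + α * z * deriv (deriv f) z / deriv f z +
        α * z * (deriv f z - deriv (fun u => Φ (f u)) z) / Φ (f z)) := by
  have h : α * z ^ 2 * deriv (deriv f) z / Φ (f z) =
      z * deriv f z / Φ (f z) * (α * z * deriv (deriv f) z / deriv f z) := by
    field_simp
  rw [phiExpr, if_neg hz, h]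
  ring

end PhiLike

open PhiLike

/-! With p = z f'/Φ(f), differentiation gives Ψ_f = α p² + (1 - α) p + α z p' (`phiExpr_eq_hFun`),
so every claim compares p with some q through this operator. Put β = (1 - α)/α; after division by α
the operator applied to q is the member u = 1 of the family L_u = q² + β q + u z q' (`chain`). For u
≥ 0, Re (L_u'/q') = Re (β + 2q) + u Re ((z q')'/q') > 0, because q is convex. Hence L_u is close to
convex and univalent, and its values move outward as u grows: for t ≥ 0, L_u(ζ) + t ζ q'(ζ) is not a
value of L_u at any other point of |z| ≤ |ζ| (`ConvexUnivalent.ne_add_mul`).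

If p ≺ q fails, `exists_contact_of_not_subordinate` gives p(z) = q(ζ) and z p'(z) = m ζ q'(ζ) with m
≥ 1 and |z| < |ζ| < 1. The operator of p at z is then L_m(ζ), which L_1 does not take on |x| ≤ |z|:
a contradiction. If q ≺ p fails, the roles are exchanged: the operator of p at ζ is L_{1/m}(z),
which L_1 takes inside |y| < |ζ| (`ConvexUnivalent.chain_mem_image`). So the operator of p repeats
this value at a point of modulus below |ζ|, against its injectivity.

Both bounds are best because each q_i is itself a solution. -/

/-! ### Injective analytic functions and their local inverses. -/

/-- An injective analytic function on an open set has no critical points. -/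
theorem deriv_ne_zero_of_injOn {f : ℂ → ℂ} {s : Set ℂ} (hs : IsOpen s)
    (hf : AnalyticOnNhd ℂ f s) (hinj : InjOn f s) {z : ℂ} (hz : z ∈ s) : deriv f z ≠ 0 := by
  intro h0
  have hfz := hf z hz
  have hord := hfz.analyticOrderAt_deriv_add_one
  have hd : analyticOrderAt (deriv f) z ≠ 0 := by
    rw [Ne, hfz.deriv.analyticOrderAt_eq_zero]
    simpa using h0
  generalize hr : analyticOrderAt (f · - f z) z = r at hord
  cases r with
  | top =>
    rw [analyticOrderAt_eq_top] at hr
    have h1 : ∀ᶠ y in 𝓝[≠] z, y ∈ s ∧ f y - f z = 0 ∧ y ≠ z :=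
      ((hs.eventually_mem hz).filter_mono nhdsWithin_le_nhds).and
        ((hr.filter_mono nhdsWithin_le_nhds).and eventually_mem_nhdsWithin)
    obtain ⟨y, hy, hfy, hne⟩ := h1.exists
    exact hne (hinj hy hz (sub_eq_zero.mp hfy))
  | coe n =>
    have hn : n ≠ 0 ∧ n ≠ 1 := by
      constructor
      · rintro rfl
        simp at hord
      · rintro rfl
        apply hd
        simpa using hord
    obtain ⟨F, hF, hF0, hFeq⟩ :=
      (AnalyticAt.analyticOrderAt_eq_natCast (by fun_prop)).mp hr
    -- With n ≥ 2 the order of the zero of f - f(z), k is a local coordinate with f - f(z) = F(z)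
    -- kⁿ; f then agrees at the points where k equals w and ωw, ω a primitive n-th root of unity.
    set k : ℂ → ℂ := fun y => (y - z) * Complex.exp (Complex.log (F y / F z) / n) with hk
    have hn0 : (n : ℂ) ≠ 0 := by exact_mod_cast hn.1
    have hG : AnalyticAt ℂ (fun y => Complex.exp (Complex.log (F y / F z) / n)) z := by
      refine AnalyticAt.cexp (AnalyticAt.div_const (AnalyticAt.clog (hF.div_const) ?_))
      rw [div_self hF0]
      exact Complex.one_mem_slitPlane
    have hkd : HasStrictDerivAt k 1 z := by
      have h1 := HasStrictDerivAt.mul ((hasStrictDerivAt_id z).sub_const z) hG.hasStrictDerivAt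
      simp only [id, sub_self, div_self hF0, Complex.log_one, zero_div, Complex.exp_zero, mul_one,
        zero_mul, add_zero] at h1
      exact h1
    have hmap := hkd.map_nhds_eq one_ne_zero
    have hkz : k z = 0 := by simp [hk]
    have hFne : ∀ᶠ y in 𝓝 z, F y ≠ 0 := hF.continuousAt.eventually_ne hF0
    have hU : ∀ᶠ y in 𝓝 z, y ∈ s ∧ f y - f z = F z * k y ^ n := by
      filter_upwards [hs.mem_nhds hz, hFeq, hFne] with y hy h1 h2
      refine ⟨hy, ?_⟩
      rw [h1, hk]
      simp only [mul_pow, ← Complex.exp_nat_mul, smul_eq_mul]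
      rw [mul_div_cancel₀ _ hn0, Complex.exp_log (div_ne_zero h2 hF0)]
      field_simp
    have hV : k '' {y | y ∈ s ∧ f y - f z = F z * k y ^ n} ∈ 𝓝 (0 : ℂ) := by
      rw [← hkz, ← hmap]
      exact image_mem_map hU
    have hω := Complex.isPrimitiveRoot_exp n hn.1
    set ω := Complex.exp (2 * Real.pi * Complex.I / n)
    have hω1 : ω ≠ 1 := hω.ne_one (by omega)
    have hV2 : ∀ᶠ w in 𝓝 (0 : ℂ), ω * w ∈ k '' {y | y ∈ s ∧ f y - f z = F z * k y ^ n} := by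
      have : Tendsto (fun w : ℂ => ω * w) (𝓝 0) (𝓝 0) := by
        have : Continuous (fun w : ℂ => ω * w) := by fun_prop
        simpa using this.tendsto 0
      exact this hV
    have h1 : ∀ᶠ w in 𝓝[≠] (0 : ℂ), w ∈ k '' {y | y ∈ s ∧ f y - f z = F z * k y ^ n} ∧
        ω * w ∈ k '' {y | y ∈ s ∧ f y - f z = F z * k y ^ n} ∧ w ≠ 0 :=
      (Filter.Eventually.filter_mono nhdsWithin_le_nhds hV).and
        ((hV2.filter_mono nhdsWithin_le_nhds).and eventually_mem_nhdsWithin)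
    obtain ⟨w, ⟨y₁, hy₁, hw₁⟩, ⟨y₂, hy₂, hw₂⟩, hw0⟩ := h1.exists
    have h2 : f y₁ = f y₂ := by
      have : f y₁ - f z = f y₂ - f z := by
        rw [hy₁.2, hy₂.2, hw₁, hw₂, mul_pow, hω.pow_eq_one, one_mul]
      simpa using this
    have h3 := hinj hy₁.1 hy₂.1 h2
    rw [h3, hw₂] at hw₁
    exact hω1 (mul_right_cancel₀ hw0 (by simpa using hw₁))

/-- The image of an open set under an injective analytic function is open. -/
theorem isOpen_image_of_injOn {f : ℂ → ℂ} {s t : Set ℂ} (hs : IsOpen s)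
    (hf : AnalyticOnNhd ℂ f s) (hinj : InjOn f s) (ht : IsOpen t) (hts : t ⊆ s) :
    IsOpen (f '' t) := by
  rw [isOpen_iff_mem_nhds]
  rintro _ ⟨z, hz, rfl⟩
  rw [← (hf z (hts hz)).hasStrictDerivAt.map_nhds_eq (deriv_ne_zero_of_injOn hs hf hinj (hts hz))]
  exact image_mem_map (ht.mem_nhds hz)

theorem hasDerivAt_invFunOn {f : ℂ → ℂ} {s : Set ℂ} (hs : IsOpen s)
    (hf : AnalyticOnNhd ℂ f s) (hinj : InjOn f s) {z : ℂ} (hz : z ∈ s) :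
    HasDerivAt (Function.invFunOn f s) (deriv f z)⁻¹ (f z) := by
  have hinv : Function.invFunOn f s (f z) = z := hinj.leftInvOn_invFunOn hz
  have hopen : f '' s ∈ 𝓝 (f z) :=
    (isOpen_image_of_injOn hs hf hinj hs subset_rfl).mem_nhds (mem_image_of_mem f hz)
  refine HasDerivAt.of_local_left_inverse (f := f) ?_ ?_ (deriv_ne_zero_of_injOn hs hf hinj hz) ?_
  · rw [ContinuousAt, hinv]
    intro V hV
    obtain ⟨t, htV, ht, hzt⟩ := mem_nhds_iff.mp (inter_mem hV (hs.mem_nhds hz))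
    have h1 : f '' t ∈ 𝓝 (f z) :=
      (isOpen_image_of_injOn hs hf hinj ht (fun y hy => (htV hy).2)).mem_nhds
        (mem_image_of_mem f hzt)
    refine mem_map.mpr (mem_of_superset h1 ?_)
    rintro _ ⟨y, hy, rfl⟩
    rw [mem_preimage, hinj.leftInvOn_invFunOn (htV hy).2]
    exact (htV hy).1
  · rw [hinv]
    exact (hf z hz).differentiableAt.hasDerivAt
  · filter_upwards [hopen] with w hw
    exact Function.invFunOn_eq hw

/-! ### Inverses on the disk, the Schwarz lemma and subordination. -/

namespace PhiLike

theorem isOpen_disk : IsOpen disk := Metric.isOpen_ball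

theorem mem_disk {z : ℂ} : z ∈ disk ↔ ‖z‖ < 1 := by simp [disk]

theorem zero_mem_disk : (0 : ℂ) ∈ disk := by simp [disk]

theorem Univalent.deriv_ne_zero {q : ℂ → ℂ} (hq : Univalent q) {z : ℂ} (hz : z ∈ disk) :
    deriv q z ≠ 0 :=
  deriv_ne_zero_of_injOn isOpen_disk hq.1 hq.2 hz

theorem Univalent.isOpen_image {q : ℂ → ℂ} (hq : Univalent q) {t : Set ℂ} (ht : IsOpen t)
    (hts : t ⊆ disk) : IsOpen (q '' t) :=
  isOpen_image_of_injOn isOpen_disk hq.1 hq.2 ht hts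

/-- The inverse of a univalent function on the image of the disk. -/
noncomputable def inverse (q : ℂ → ℂ) : ℂ → ℂ := Function.invFunOn q disk

theorem Univalent.inverse_apply {q : ℂ → ℂ} (hq : Univalent q) {z : ℂ} (hz : z ∈ disk) :
    inverse q (q z) = z :=
  hq.2.leftInvOn_invFunOn hz

theorem inverse_mem {q : ℂ → ℂ} {w : ℂ} (hw : w ∈ q '' disk) : inverse q w ∈ disk :=
  Function.invFunOn_mem hw

theorem apply_inverse {q : ℂ → ℂ} {w : ℂ} (hw : w ∈ q '' disk) : q (inverse q w) = w :=
  Function.invFunOn_eq hw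

theorem Univalent.hasDerivAt_inverse {q : ℂ → ℂ} (hq : Univalent q) {w : ℂ}
    (hw : w ∈ q '' disk) : HasDerivAt (inverse q) (deriv q (inverse q w))⁻¹ w := by
  have := hasDerivAt_invFunOn isOpen_disk hq.1 hq.2 (inverse_mem hw)
  rwa [apply_inverse hw] at this

theorem Univalent.analyticOnNhd_inverse {q : ℂ → ℂ} (hq : Univalent q) :
    AnalyticOnNhd ℂ (inverse q) (q '' disk) :=
  DifferentiableOn.analyticOnNhd
    (fun _ hw => (hq.hasDerivAt_inverse hw).differentiableAt.differentiableWithinAt)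
    (hq.isOpen_image isOpen_disk subset_rfl)

/-- The Schwarz lemma for the lift of `a` through a univalent function `b`. -/
theorem Univalent.norm_inverse_comp_le {a b : ℂ → ℂ} (hb : Univalent b) {r ρ : ℝ}
    (hρ : ρ ≤ 1) (ha : AnalyticOnNhd ℂ a (Metric.ball 0 r)) (h0 : a 0 = b 0)
    (hmap : ∀ z, ‖z‖ < r → a z ∈ b '' Metric.ball 0 ρ) {z : ℂ} (hz : ‖z‖ < r) :
    ‖inverse b (a z)‖ ≤ ρ / r * ‖z‖ := by
  have hsub : Metric.ball (0 : ℂ) ρ ⊆ disk := Metric.ball_subset_ball hρ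
  have hd : DifferentiableOn ℂ (fun y => inverse b (a y)) (Metric.ball 0 r) := by
    intro y hy
    have hy' := image_mono hsub (hmap y (by simpa using hy))
    exact ((hb.hasDerivAt_inverse hy').differentiableAt.comp y
      (ha y hy).differentiableAt).differentiableWithinAt
  have h00 : inverse b (a 0) = 0 := by rw [h0, hb.inverse_apply zero_mem_disk]
  have hm : MapsTo (fun y => inverse b (a y)) (Metric.ball 0 r)
      (Metric.closedBall (inverse b (a 0)) ρ) := by
    intro y hy
    obtain ⟨x, hx, hxy⟩ := hmap y (by simpa using hy)
    rw [h00]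
    show inverse b (a y) ∈ _
    rw [← hxy, hb.inverse_apply (hsub hx)]
    exact Metric.ball_subset_closedBall hx
  have := Complex.dist_le_div_mul_dist_of_mapsTo_ball hd hm (z := z) (by simpa using hz)
  simpa [h00] using this

theorem Univalent.subordinate {a b : ℂ → ℂ} (hb : Univalent b)
    (ha : AnalyticOnNhd ℂ a disk) (h0 : a 0 = b 0) (hmap : ∀ z ∈ disk, a z ∈ b '' disk) :
    Subordinate a b := by
  refine ⟨fun z => inverse b (a z), fun z hz => ?_, ?_, fun z hz => ?_, fun z hz => ?_⟩
  · exact (hb.analyticOnNhd_inverse _ (hmap z hz)).comp (ha z hz)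
  · show inverse b (a 0) = 0
    rw [h0, hb.inverse_apply zero_mem_disk]
  · exact mem_disk.mp (inverse_mem (hmap z hz))
  · exact (apply_inverse (hmap z hz)).symm

/-- By the Schwarz lemma the matching point is no farther from 0, which is all the comparison
arguments need from a subordination. -/
theorem Subordinate.exists_norm_le {a b : ℂ → ℂ} (h : Subordinate a b) {z : ℂ}
    (hz : z ∈ disk) : ∃ x, ‖x‖ ≤ ‖z‖ ∧ a z = b x := by
  obtain ⟨w, hw, hw0, hw1, hab⟩ := h
  refine ⟨w z, ?_, hab z hz⟩
  refine Complex.norm_le_norm_of_mapsTo_ball (R := 1) hw.differentiableOn ?_ hw0 (mem_disk.mp hz)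
  intro y hy
  simpa using (hw1 y hy).le

/-! ### Convex and close-to-convex functions. -/

/-- The right derivative of |γ|² at 0 is 2 Re (conj γ(0) · γ'), a positive multiple of Re (γ'/γ(0)).
-/
theorem re_div_nonpos_of_norm_le {γ : ℝ → ℂ} {γ' : ℂ} (h : HasDerivAt γ γ' 0) (h0 : γ 0 ≠ 0)
    (hle : ∀ᶠ t in 𝓝[>] (0 : ℝ), ‖γ t‖ ≤ ‖γ 0‖) : (γ' / γ 0).re ≤ 0 := by
  have hd := h.norm_sq
  have h1 : Tendsto (slope (fun t => ‖γ t‖ ^ 2) 0) (𝓝[>] 0) (𝓝 (2 * inner ℝ (γ 0) γ')) :=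
    (hasDerivAt_iff_tendsto_slope.mp hd).mono_left
      (nhdsWithin_mono _ fun x hx => ne_of_gt hx)
  have h2 : 2 * inner ℝ (γ 0) γ' ≤ 0 := by
    refine le_of_tendsto h1 ?_
    filter_upwards [hle, self_mem_nhdsWithin] with t ht htpos
    rw [slope_def_field, sub_zero]
    refine div_nonpos_of_nonpos_of_nonneg ?_ (le_of_lt htpos)
    have := pow_le_pow_left₀ (norm_nonneg _) ht 2
    linarith
  have h3 : γ' / γ 0 = (starRingEnd ℂ (γ 0) * γ') * ((‖γ 0‖ ^ 2)⁻¹ : ℝ) := by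
    rw [div_eq_mul_inv, Complex.inv_def, Complex.normSq_eq_norm_sq]
    ring
  rw [h3, Complex.re_mul_ofReal]
  have h4 : (starRingEnd ℂ (γ 0) * γ').re ≤ 0 := by
    have h5 := Complex.inner (γ 0) γ'
    rw [mul_comm, ← h5]
    linarith
  exact mul_nonpos_of_nonpos_of_nonneg h4 (by positivity)

/-- At boundary points of the image of a disk, the convex image lies on one side of the tangent. -/
theorem ConvexUnivalent.re_sub_div_nonpos {q : ℂ → ℂ} (hq : ConvexUnivalent q) {z ζ : ℂ}
    (hζ : ζ ∈ disk) (hζ0 : ζ ≠ 0) (hz : ‖z‖ ≤ ‖ζ‖) :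
    ((q z - q ζ) / (ζ * deriv q ζ)).re ≤ 0 := by
  set c := z / ζ with hc
  have hc1 : ‖c‖ ≤ 1 := by
    rw [hc, norm_div]
    exact div_le_one_of_le₀ hz (norm_nonneg _)
  have hcd : ∀ y ∈ disk, c * y ∈ disk := fun y hy => by
    rw [mem_disk] at hy ⊢
    rw [norm_mul]
    exact lt_of_le_of_lt (mul_le_of_le_one_left (norm_nonneg _) hc1) hy
  have hcζ : c * ζ = z := div_mul_cancel₀ _ hζ0
  -- By convexity y ↦ (1 - t) q(y) + t q(cy) maps into the image of q and agrees with q at 0; the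
  -- Schwarz bound at y = ζ, where cζ = z, keeps the lifted segment in |x| ≤ |ζ|.
  have hbound : ∀ t ∈ Icc (0 : ℝ) 1, ‖inverse q (q ζ + t * (q z - q ζ))‖ ≤ ‖ζ‖ := by
    intro t ht
    have ha : AnalyticOnNhd ℂ (fun y => q y + t * (q (c * y) - q y)) (Metric.ball 0 1) := by
      intro y hy
      have h1 : AnalyticAt ℂ (fun y => q (c * y)) y :=
        (hq.1.1 _ (hcd y hy)).fun_comp (by fun_prop)
      have h2 := hq.1.1 y hy
      exact h2.add (analyticAt_const.mul (h1.sub h2))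
    have := hq.1.norm_inverse_comp_le le_rfl ha (by simp) (fun y hy => ?_) (mem_disk.mp hζ)
    · simpa [hcζ] using this
    · have hy' : y ∈ disk := mem_disk.mpr hy
      have := hq.2 (mem_image_of_mem q hy') (mem_image_of_mem q (hcd y hy'))
        (sub_nonneg.mpr ht.2) ht.1 (sub_add_cancel 1 t)
      refine (congrArg (· ∈ q '' disk) ?_).mp this
      show (1 - t : ℝ) * q y + t * q (c * y) = q y + t * (q (c * y) - q y)
      push_cast
      ring
  have hζ' : q ζ ∈ q '' disk := mem_image_of_mem q hζ
  have hline : HasDerivAt (fun t : ℝ => q ζ + t * (q z - q ζ)) (q z - q ζ) 0 := by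
    have h1 : HasDerivAt (fun t : ℝ => (t : ℂ)) 1 0 := Complex.ofRealCLM.hasDerivAt
    simpa using (h1.mul_const (q z - q ζ)).const_add (q ζ)
  have hinv : HasDerivAt (inverse q) (deriv q ζ)⁻¹ (q ζ + (0 : ℝ) * (q z - q ζ)) := by
    have := hq.1.hasDerivAt_inverse hζ'
    rw [hq.1.inverse_apply hζ] at this
    simpa using this
  have hγ := hinv.comp 0 hline
  have hγ0 : (inverse q ∘ fun t : ℝ => q ζ + t * (q z - q ζ)) 0 = ζ := by
    simp [hq.1.inverse_apply hζ]
  have := re_div_nonpos_of_norm_le hγ (by rwa [hγ0]) ?_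
  · rw [hγ0] at this
    convert this using 2
    rw [div_mul_eq_div_div_swap]
    ring
  · rw [hγ0]
    filter_upwards [Ioc_mem_nhdsGT (zero_lt_one' ℝ)] with t ht
    exact hbound t ⟨ht.1.le, ht.2⟩

theorem inv_re_nonneg {w : ℂ} (h : 0 ≤ w.re) : 0 ≤ (w⁻¹).re := by
  rw [Complex.inv_re]
  exact div_nonneg h (Complex.normSq_nonneg _)

theorem ConvexUnivalent.re_div_sub_nonneg {q : ℂ → ℂ} (hq : ConvexUnivalent q) {z ζ : ℂ}
    (hζ : ζ ∈ disk) (hz : ‖z‖ ≤ ‖ζ‖) :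
    0 ≤ (ζ * deriv q ζ / (q ζ - q z)).re := by
  rcases eq_or_ne ζ 0 with rfl | h0
  · simp
  have h1 := hq.re_sub_div_nonpos hζ h0 hz
  have h2 : ζ * deriv q ζ / (q ζ - q z) = (-((q z - q ζ) / (ζ * deriv q ζ)))⁻¹ := by
    rw [← neg_div, inv_div, neg_sub]
  rw [h2]
  exact inv_re_nonneg (by simpa using h1)

/-- The analytic characterization of convexity: `Re ((z q')' / q') ≥ 0`. -/
theorem ConvexUnivalent.re_deriv_div_nonneg {q : ℂ → ℂ} (hq : ConvexUnivalent q) {z : ℂ}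
    (hz : z ∈ disk) : 0 ≤ (deriv (fun y => y * deriv q y) z / deriv q z).re := by
  have hqz := hq.1.1 z hz
  have hG : DifferentiableAt ℂ (fun y => y * deriv q y) z :=
    differentiableAt_id.mul hqz.deriv.differentiableAt
  rcases eq_or_ne z 0 with rfl | hz0
  · have h1 : deriv (fun y => y * deriv q y) 0 = deriv q 0 := by
      have := ((hasDerivAt_id (0 : ℂ)).mul hqz.deriv.differentiableAt.hasDerivAt).deriv
      simp only [id, zero_mul, one_mul, add_zero] at this
      exact this
    rw [h1, div_self (hq.1.deriv_ne_zero hz)]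
    simp
  set γ : ℝ → ℂ := fun θ => z * Complex.exp (θ * Complex.I) with hγdef
  have hγ0 : γ 0 = z := by simp [hγdef]
  have hγn : ∀ θ, ‖γ θ‖ = ‖z‖ := fun θ => by simp [hγdef, Complex.norm_exp_ofReal_mul_I]
  have hγ : HasDerivAt γ (z * Complex.I) 0 := by
    have h1 : HasDerivAt (fun t : ℝ => (t : ℂ)) 1 0 := Complex.ofRealCLM.hasDerivAt
    simpa using ((h1.mul_const Complex.I).cexp).const_mul z
  have hcomp : ∀ g : ℂ → ℂ, DifferentiableAt ℂ g z →
      HasDerivAt (fun θ => g (γ θ)) (deriv g z * (z * Complex.I)) 0 := by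
    intro g hg
    have h1 := hg.hasDerivAt
    rw [← hγ0] at h1
    have h2 := h1.comp 0 hγ
    rw [hγ0] at h2
    exact h2
  have hGγ : HasDerivAt (fun θ => γ θ * deriv q (γ θ))
      (deriv (fun y => y * deriv q y) z * (z * Complex.I)) 0 := hcomp _ hG
  have hqγ : HasDerivAt (fun θ => q (γ θ)) (deriv q z * (z * Complex.I)) 0 :=
    hcomp _ hqz.differentiableAt
  have hzI : z * Complex.I ≠ 0 := mul_ne_zero hz0 Complex.I_ne_zero
  have hlim := (hasDerivAt_iff_tendsto_slope.mp hGγ).div (hasDerivAt_iff_tendsto_slope.mp hqγ)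
    (mul_ne_zero (hq.1.deriv_ne_zero hz) hzI)
  rw [mul_div_mul_right _ _ hzI] at hlim
  refine ge_of_tendsto ((Complex.continuous_re.tendsto _).comp hlim) ?_
  filter_upwards [self_mem_nhdsWithin] with θ hθ
  have hθ0 : (((θ - 0 : ℝ))⁻¹ : ℂ) ≠ 0 := by
    simpa using hθ
  have hmem : γ θ ∈ disk := by rw [mem_disk, hγn]; exact mem_disk.mp hz
  have h1 := hq.re_div_sub_nonneg hmem (z := z) (hγn θ).ge
  have h2 := hq.re_div_sub_nonneg hz (z := γ θ) (hγn θ).le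
  -- The difference quotient of z q' over that of q splits into two terms of `re_div_sub_nonneg`;
  -- rotation preserves the modulus, so that lemma applies in both orders.
  have h3 : (slope (fun θ => γ θ * deriv q (γ θ)) 0 / slope (fun θ => q (γ θ)) 0) θ =
      γ θ * deriv q (γ θ) / (q (γ θ) - q z) + z * deriv q z / (q z - q (γ θ)) := by
    rw [Pi.div_apply, slope_def_module, slope_def_module, hγ0, Complex.real_smul,
      Complex.real_smul, Complex.ofReal_inv, mul_div_mul_left _ _ hθ0, ← neg_sub (q (γ θ)) (q z),
      div_neg, sub_div, sub_eq_add_neg]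
  show 0 ≤ Complex.re _
  rw [h3, Complex.add_re]
  exact add_nonneg h1 h2

/-- The Noshiro–Warschawski argument for functions that are close to convex. -/
theorem ConvexUnivalent.re_sub_div_sub_pos {q g : ℂ → ℂ} (hq : ConvexUnivalent q)
    (hg : AnalyticOnNhd ℂ g disk) (hre : ∀ z ∈ disk, 0 < (deriv g z / deriv q z).re)
    {z ζ : ℂ} (hz : z ∈ disk) (hζ : ζ ∈ disk) (hne : z ≠ ζ) :
    0 < ((g z - g ζ) / (q z - q ζ)).re := by
  set d := q z - q ζ with hd
  have hd0 : d ≠ 0 := sub_ne_zero.mpr fun h => hne (hq.1.2 hz hζ h)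
  -- The lift by q of the segment from q(ζ) to q(z), which convexity keeps in the image; Re (g(σ)/d)
  -- increases along it.
  set σ : ℝ → ℂ := fun t => inverse q (q ζ + t * d) with hσ
  have hmem : ∀ t ∈ Icc (0 : ℝ) 1, q ζ + t * d ∈ q '' disk := by
    intro t ht
    have := hq.2 (mem_image_of_mem q hζ) (mem_image_of_mem q hz)
      (sub_nonneg.mpr ht.2) ht.1 (sub_add_cancel 1 t)
    convert this using 1
    show q ζ + t * (q z - q ζ) = (1 - t : ℝ) * q ζ + t * q z
    push_cast
    ring
  have hder : ∀ t ∈ Icc (0 : ℝ) 1, HasDerivAt (fun t => (g (σ t) / d).re)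
      (deriv g (σ t) / deriv q (σ t)).re t := by
    intro t ht
    have hline : HasDerivAt (fun t : ℝ => q ζ + t * d) d t := by
      have h1 : HasDerivAt (fun t : ℝ => (t : ℂ)) 1 t := Complex.ofRealCLM.hasDerivAt
      simpa using (h1.mul_const d).const_add (q ζ)
    have hσt : HasDerivAt σ ((deriv q (σ t))⁻¹ * d) t :=
      (hq.1.hasDerivAt_inverse (hmem t ht)).comp t hline
    have hgt := ((hg _ (inverse_mem (hmem t ht))).differentiableAt.hasDerivAt.comp t
      hσt).div_const d
    have := Complex.reCLM.hasFDerivAt.comp_hasDerivAt t hgt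
    refine this.congr_deriv (congrArg Complex.re ?_)
    show deriv g (σ t) * ((deriv q (σ t))⁻¹ * d) / d = _
    rw [← mul_assoc, mul_div_cancel_right₀ _ hd0, div_eq_mul_inv]
  have hmono : StrictMonoOn (fun t => (g (σ t) / d).re) (Icc 0 1) := by
    refine strictMonoOn_of_deriv_pos (convex_Icc 0 1)
      (fun t ht => (hder t ht).continuousAt.continuousWithinAt) fun t ht => ?_
    have ht' := interior_subset ht
    rw [(hder t ht').deriv]
    exact hre _ (inverse_mem (hmem t ht'))
  have h01 := hmono (left_mem_Icc.mpr zero_le_one) (right_mem_Icc.mpr zero_le_one) zero_lt_one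
  have hσ0 : σ 0 = ζ := by simp [hσ, hq.1.inverse_apply hζ]
  have hσ1 : σ 1 = z := by simp [hσ, hd, hq.1.inverse_apply hz]
  simp only [hσ0, hσ1] at h01
  rw [sub_div, Complex.sub_re]
  linarith

/-- A close to convex function avoids the rays normal to the level curves of the convex one. -/
theorem ConvexUnivalent.ne_add_mul {q g : ℂ → ℂ} (hq : ConvexUnivalent q)
    (hg : AnalyticOnNhd ℂ g disk) (hre : ∀ z ∈ disk, 0 < (deriv g z / deriv q z).re)
    {z ζ : ℂ} (hζ : ζ ∈ disk) (hz : ‖z‖ ≤ ‖ζ‖) (hne : z ≠ ζ) {t : ℝ} (ht : 0 ≤ t) :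
    g z ≠ g ζ + t * (ζ * deriv q ζ) := by
  intro h
  have hz' : z ∈ disk := mem_disk.mpr (hz.trans_lt (mem_disk.mp hζ))
  have h1 := hq.re_sub_div_sub_pos hg hre hz' hζ hne
  have h2 := hq.re_div_sub_nonneg hζ hz
  -- Equality would make a quotient of positive real part equal to -t times one of nonnegative real
  -- part.
  have h3 : (g z - g ζ) / (q z - q ζ) = -(t * (ζ * deriv q ζ / (q ζ - q z))) := by
    rw [h, add_sub_cancel_left, ← neg_sub (q ζ) (q z), div_neg, mul_div_assoc]
  rw [h3, Complex.neg_re, Complex.re_ofReal_mul] at h1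
  linarith [mul_nonneg ht h2]

/-! ### Jack's lemma and contact points. -/

/-- The choice d = -1 handles the real part; d = -δ ± i with δ small forces the imaginary part to
vanish. -/
theorem eq_ofReal_of_re_mul_nonpos {c : ℂ} (h : ∀ d : ℂ, d.re < 0 → (d * c).re ≤ 0) :
    0 ≤ c.re ∧ c.im = 0 := by
  have h1 := h (-1) (by simp)
  have hre : 0 ≤ c.re := by simpa using h1
  refine ⟨hre, ?_⟩
  have key : ∀ δ : ℝ, 0 < δ → |c.im| ≤ δ * c.re := by
    intro δ hδ
    have h2 := h (-δ + Complex.I) (by simpa using hδ)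
    have h3 := h (-δ - Complex.I) (by simpa using hδ)
    simp [Complex.mul_re] at h2 h3
    rw [abs_le]
    constructor <;> linarith
  by_contra him
  have hpos : 0 < |c.im| := abs_pos.mpr him
  -- This δ would give |Im c| ≤ |Im c| · Re c / (2 (Re c + 1)) < |Im c|.
  have h4 := key (|c.im| / (2 * (c.re + 1))) (by positivity)
  rw [div_mul_eq_mul_div, le_div_iff₀ (by positivity)] at h4
  nlinarith

theorem eventually_norm_one_add_lt {d : ℂ} (hd : d.re < 0) :
    ∀ᶠ t : ℝ in 𝓝[>] 0, ‖1 + t * d‖ < 1 := by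
  have hd0 : d ≠ 0 := by rintro rfl; simp at hd
  have hn : 0 < Complex.normSq d := Complex.normSq_pos.mpr hd0
  have hpos : 0 < -2 * d.re / Complex.normSq d := div_pos (by linarith) hn
  filter_upwards [Ioo_mem_nhdsGT hpos] with t ht
  have h1 : t * Complex.normSq d < -2 * d.re := (lt_div_iff₀ hn).mp ht.2
  have h2 : ‖1 + t * d‖ ^ 2 = 1 + t * (2 * d.re + t * Complex.normSq d) := by
    rw [← Complex.normSq_eq_norm_sq, Complex.normSq_apply, Complex.normSq_apply]
    simp
    ring
  have h3 : t * (2 * d.re + t * Complex.normSq d) < 0 :=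
    mul_neg_of_pos_of_neg ht.1 (by linarith)
  exact lt_of_pow_lt_pow_left₀ 2 zero_le_one (by rw [h2]; linarith)

/-- **Jack's lemma.** -/
theorem exists_mul_deriv_eq {K : ℂ → ℂ} {z₀ : ℂ} {k : ℝ} (hz₀ : z₀ ≠ 0) (hk : 0 < k)
    (hK : DifferentiableAt ℂ K z₀) (hle : ∀ z, ‖z‖ < ‖z₀‖ → ‖K z‖ ≤ k * ‖z‖)
    (heq : ‖K z₀‖ = k * ‖z₀‖) : ∃ m : ℝ, 1 ≤ m ∧ z₀ * deriv K z₀ = m * K z₀ := by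
  have hK0 : K z₀ ≠ 0 := by
    rw [← norm_pos_iff, heq]
    exact mul_pos hk (norm_pos_iff.mpr hz₀)
  -- Every direction z₀ d with Re d < 0 enters the disk |z| < |z₀|, where |K(z)/z| ≤ k, the value
  -- attained at z₀. Differentiating K(z₀(1 + td))/(1 + td) gives Re (d c) ≤ 0.
  have hc := eq_ofReal_of_re_mul_nonpos (c := z₀ * deriv K z₀ / K z₀ - 1) fun d hd => by
    have hlin : HasDerivAt (fun t : ℝ => 1 + t * d) d 0 := by
      have h1 : HasDerivAt (fun t : ℝ => (t : ℂ)) 1 0 := Complex.ofRealCLM.hasDerivAt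
      simpa using (h1.mul_const d).const_add 1
    have hKd : HasDerivAt K (deriv K z₀) (z₀ * (1 + (0 : ℝ) * d)) := by
      simpa using hK.hasDerivAt
    have hne : 1 + ((0 : ℝ) : ℂ) * d ≠ 0 := by simp
    have hγ := (hKd.comp 0 (hlin.const_mul z₀)).div hlin hne
    have h0 : ((K ∘ fun t : ℝ => z₀ * (1 + t * d)) / fun t : ℝ => 1 + t * d) 0 = K z₀ := by
      simp
    have := re_div_nonpos_of_norm_le hγ (by rwa [h0]) ?_
    · rw [h0] at this
      convert this using 2
      simp
      field_simp
    · rw [h0]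
      filter_upwards [eventually_norm_one_add_lt hd,
        (hlin.continuousAt.eventually_ne hne).filter_mono nhdsWithin_le_nhds] with t ht ht0
      have hpos : 0 < ‖1 + t * d‖ := norm_pos_iff.mpr ht0
      have h2 := hle (z₀ * (1 + t * d)) (by
        rw [norm_mul]
        exact mul_lt_of_lt_one_right (norm_pos_iff.mpr hz₀) ht)
      show ‖K (z₀ * (1 + t * d)) / (1 + t * d)‖ ≤ _
      rw [norm_div, div_le_iff₀ hpos, heq]
      rw [norm_mul] at h2
      linarith
  refine ⟨1 + (z₀ * deriv K z₀ / K z₀ - 1).re, by linarith [hc.1], ?_⟩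
  have h1 : (((z₀ * deriv K z₀ / K z₀ - 1).re : ℝ) : ℂ) = z₀ * deriv K z₀ / K z₀ - 1 :=
    Complex.ext (by simp) (by simpa using hc.2.symm)
  rw [Complex.ofReal_add, h1]
  field_simp
  simp

/-- The Miller–Mocanu lemma: failure of subordination produces boundary contact points. -/
theorem exists_contact_of_not_subordinate {a b : ℂ → ℂ} (ha : AnalyticOnNhd ℂ a disk)
    (hb : Univalent b) (h0 : a 0 = b 0) (hnot : ¬ Subordinate a b) :
    ∃ z₀ ζ₀ : ℂ, ∃ m : ℝ, ‖z₀‖ < ‖ζ₀‖ ∧ ζ₀ ∈ disk ∧ a z₀ = b ζ₀ ∧ 1 ≤ m ∧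
      z₀ * deriv a z₀ = m * (ζ₀ * deriv b ζ₀) := by
  obtain ⟨y, hy, hyb⟩ : ∃ y ∈ disk, a y ∉ b '' disk := by
    by_contra! h
    exact hnot (hb.subordinate ha h0 h)
  obtain ⟨ρ, hyρ, hρ1⟩ := exists_between (mem_disk.mp hy)
  have hρ0 : 0 < ρ := (norm_nonneg y).trans_lt hyρ
  have hballc : Metric.closedBall (0 : ℂ) ρ ⊆ disk := Metric.closedBall_subset_ball hρ1
  have hball : Metric.ball (0 : ℂ) ρ ⊆ disk := Metric.ball_subset_ball hρ1.le
  have hopen := hb.isOpen_image Metric.isOpen_ball hball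
  have hcont : ContinuousOn a (Metric.closedBall 0 ρ) := ha.continuousOn.mono hballc
  have hKc : IsCompact (Metric.closedBall (0 : ℂ) ρ ∩ a ⁻¹' (b '' Metric.ball 0 ρ)ᶜ) :=
    (isCompact_closedBall 0 ρ).of_isClosed_subset
      (hcont.preimage_isClosed_of_isClosed Metric.isClosed_closedBall hopen.isClosed_compl)
      inter_subset_left
  have hyK : y ∈ Metric.closedBall (0 : ℂ) ρ ∩ a ⁻¹' (b '' Metric.ball 0 ρ)ᶜ :=
    ⟨by simpa using hyρ.le, fun h => hyb (image_mono hball h)⟩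
  -- z₀ is a point of least modulus sent outside b(|ζ| < ρ). As |z₀| ≤ |y| < ρ, the contact with
  -- b(|ζ| = ρ) occurs at ‖z₀‖ < ‖ζ₀‖.
  obtain ⟨z₀, hz₀K, hmin⟩ := hKc.exists_isMinOn ⟨y, hyK⟩ continuous_norm.continuousOn
  have hz₀ρ : ‖z₀‖ < ρ := lt_of_le_of_lt (hmin hyK) hyρ
  have hz₀d : z₀ ∈ disk := hballc hz₀K.1
  have hmap : ∀ z, ‖z‖ < ‖z₀‖ → a z ∈ b '' Metric.ball 0 ρ := by
    intro z hz
    by_contra h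
    have : ‖z₀‖ ≤ ‖z‖ := hmin (show z ∈ _ from ⟨by simpa using (hz.trans hz₀ρ).le, h⟩)
    linarith
  have hz₀0 : z₀ ≠ 0 := by
    rintro rfl
    exact hz₀K.2 ⟨0, by simpa using hρ0, h0.symm⟩
  have hz₀pos : 0 < ‖z₀‖ := norm_pos_iff.mpr hz₀0
  have hcl : a z₀ ∈ b '' Metric.closedBall 0 ρ := by
    have hclosed : IsClosed (b '' Metric.closedBall 0 ρ) :=
      ((isCompact_closedBall 0 ρ).image_of_continuousOn
        (hb.1.continuousOn.mono hballc)).isClosed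
    have hz₀cl : z₀ ∈ closure (Metric.ball (0 : ℂ) ‖z₀‖) := by
      rw [closure_ball _ hz₀pos.ne']
      simp
    have := (ha z₀ hz₀d).continuousAt.continuousWithinAt.mem_closure
      (t := b '' Metric.closedBall 0 ρ) hz₀cl fun z hz =>
        image_mono Metric.ball_subset_closedBall (hmap z (by simpa using hz))
    rwa [hclosed.closure_eq] at this
  obtain ⟨ζ₀, hζ₀, hab⟩ := hcl
  have hζ₀d : ζ₀ ∈ disk := hballc hζ₀
  have hζ₀n : ‖ζ₀‖ = ρ := by
    refine le_antisymm (by simpa using hζ₀) (not_lt.mp fun h => hz₀K.2 ⟨ζ₀, by simpa using h, hab⟩)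
  have hW₀ : inverse b (a z₀) = ζ₀ := by rw [← hab, hb.inverse_apply hζ₀d]
  have hder : HasDerivAt (fun z => inverse b (a z)) ((deriv b ζ₀)⁻¹ * deriv a z₀) z₀ := by
    have h1 := hb.hasDerivAt_inverse (w := a z₀) ⟨ζ₀, hζ₀d, hab⟩
    rw [hW₀] at h1
    exact h1.comp z₀ (ha z₀ hz₀d).differentiableAt.hasDerivAt
  -- Jack's lemma for the lift b⁻¹ ∘ a: the Schwarz bound on |z| < |z₀| has slope ρ/|z₀| and is
  -- attained at z₀.
  obtain ⟨m, hm, heq⟩ := exists_mul_deriv_eq (k := ρ / ‖z₀‖) hz₀0 (div_pos hρ0 hz₀pos)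
    hder.differentiableAt
    (fun z hz => hb.norm_inverse_comp_le hρ1.le
      (ha.mono fun z hz => mem_disk.mpr ((mem_ball_zero_iff.mp hz).trans (mem_disk.mp hz₀d)))
      h0 hmap hz)
    (by rw [hW₀, hζ₀n, div_mul_cancel₀ _ hz₀pos.ne'])
  refine ⟨z₀, ζ₀, m, by rwa [hζ₀n], hζ₀d, hab.symm, hm, ?_⟩
  rw [hder.deriv, hW₀] at heq
  have hb0 := hb.deriv_ne_zero hζ₀d
  field_simp at heq
  rw [heq]
  ring

/-! ### The monotone family and the two comparison principles. -/

/-- The family `q² + β q + u z q'`. -/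
noncomputable def chain (β : ℂ) (q : ℂ → ℂ) (u : ℝ) (z : ℂ) : ℂ :=
  q z ^ 2 + β * q z + u * (z * deriv q z)

theorem analyticOnNhd_chain {β : ℂ} {q : ℂ → ℂ} (hq : AnalyticOnNhd ℂ q disk) (u : ℝ) :
    AnalyticOnNhd ℂ (chain β q u) disk := by
  intro z hz
  have h1 := hq z hz
  have h2 := h1.deriv
  exact ((h1.pow 2).add (analyticAt_const.mul h1)).add
    (analyticAt_const.mul (analyticAt_id.mul h2))

theorem chain_eq_add (β : ℂ) (q : ℂ → ℂ) (u v : ℝ) (z : ℂ) :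
    chain β q u z = chain β q v z + (u - v : ℝ) * (z * deriv q z) := by
  simp only [chain]
  push_cast
  ring

section

variable {β : ℂ} {q : ℂ → ℂ}

theorem ConvexUnivalent.re_deriv_chain_pos (hq : ConvexUnivalent q)
    (hre : ∀ z ∈ disk, 0 < (β + 2 * q z).re) {u : ℝ} (hu : 0 ≤ u) {z : ℂ} (hz : z ∈ disk) :
    0 < (deriv (chain β q u) z / deriv q z).re := by
  have hqz := hq.1.1 z hz
  have hG : DifferentiableAt ℂ (fun y => y * deriv q y) z :=
    differentiableAt_id.mul hqz.deriv.differentiableAt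
  have hq' := hqz.differentiableAt.hasDerivAt
  have hd : HasDerivAt (chain β q u)
      (2 * q z * deriv q z + β * deriv q z + u * deriv (fun y => y * deriv q y) z) z := by
    have := ((hq'.pow 2).add (hq'.const_mul β)).add (hG.hasDerivAt.const_mul (u : ℂ))
    simpa using! this
  have h0 := hq.1.deriv_ne_zero hz
  have h1 : deriv (chain β q u) z / deriv q z =
      (β + 2 * q z) + u * (deriv (fun y => y * deriv q y) z / deriv q z) := by
    rw [hd.deriv]
    field_simp
    ring
  rw [h1, Complex.add_re, Complex.re_ofReal_mul]
  exact add_pos_of_pos_of_nonneg (hre z hz) (mul_nonneg hu (hq.re_deriv_div_nonneg hz))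

theorem ConvexUnivalent.univalent_chain (hq : ConvexUnivalent q)
    (hre : ∀ z ∈ disk, 0 < (β + 2 * q z).re) {u : ℝ} (hu : 0 ≤ u) :
    Univalent (chain β q u) := by
  refine ⟨analyticOnNhd_chain hq.1.1 u, fun z hz ζ hζ h => ?_⟩
  by_contra hne
  have := hq.re_sub_div_sub_pos (analyticOnNhd_chain hq.1.1 u)
    (fun z hz => hq.re_deriv_chain_pos hre hu hz) hz hζ hne
  rw [h, sub_self, zero_div] at this
  simp at this

/-- Connectedness: the image of |y| < ρ under L_u contains the common value at 0 and never meets the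
curve L_1(|x| = ρ), since L_1(x) = L_u(x) + (1 - u) x q'(x) lies on an avoided ray. -/
theorem ConvexUnivalent.chain_mem_image (hq : ConvexUnivalent q)
    (hre : ∀ z ∈ disk, 0 < (β + 2 * q z).re) {u : ℝ} (hu : 0 ≤ u) (hu1 : u ≤ 1) {ρ : ℝ}
    (hρ : ρ < 1) {z : ℂ} (hz : ‖z‖ < ρ) :
    chain β q u z ∈ chain β q 1 '' Metric.ball 0 ρ := by
  have hballc : Metric.closedBall (0 : ℂ) ρ ⊆ disk := Metric.closedBall_subset_ball hρ
  have hball : Metric.ball (0 : ℂ) ρ ⊆ disk := Metric.ball_subset_ball hρ.le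
  have h1 := hq.univalent_chain hre zero_le_one
  have hpre : IsPreconnected (chain β q u '' Metric.ball 0 ρ) :=
    (convex_ball (0 : ℂ) ρ).isPreconnected.image _
      ((analyticOnNhd_chain hq.1.1 u).continuousOn.mono hball)
  have hclosed : IsClosed (chain β q 1 '' Metric.closedBall 0 ρ) :=
    ((isCompact_closedBall 0 ρ).image_of_continuousOn
      (h1.1.continuousOn.mono hballc)).isClosed
  refine hpre.subset_left_of_subset_union (h1.isOpen_image Metric.isOpen_ball hball)
    hclosed.isOpen_compl
    (disjoint_compl_right_iff_subset.mpr (image_mono Metric.ball_subset_closedBall)) ?_ ?_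
    (mem_image_of_mem _ (by simpa using hz))
  · rintro _ ⟨y, hy, rfl⟩
    by_contra hcon
    rw [mem_union, not_or, notMem_compl_iff] at hcon
    obtain ⟨hnot, x, hx, hxy⟩ := hcon
    have hyn : ‖y‖ < ρ := by simpa using hy
    have hxn : ‖y‖ < ‖x‖ :=
      hyn.trans_le (not_lt.mp fun h => hnot ⟨x, by simpa using h, hxy⟩)
    refine hq.ne_add_mul (analyticOnNhd_chain hq.1.1 u)
      (fun z hz => hq.re_deriv_chain_pos hre hu hz) (hballc hx) hxn.le
      (fun h => hxn.ne (by rw [h])) (sub_nonneg.mpr hu1) ?_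
    rw [← hxy]
    exact chain_eq_add β q 1 u x
  · have hρ0 : 0 < ρ := (norm_nonneg z).trans_lt hz
    exact ⟨chain β q u 0, mem_image_of_mem _ (by simpa using hρ0),
      ⟨0, by simpa using hρ0, by simp [chain]⟩⟩

theorem ConvexUnivalent.subordinate_of_chain (hq : ConvexUnivalent q)
    (hre : ∀ z ∈ disk, 0 < (β + 2 * q z).re) {p : ℂ → ℂ} (hp : AnalyticOnNhd ℂ p disk)
    (h0 : p 0 = q 0)
    (hsub : ∀ z ∈ disk, ∃ x, ‖x‖ ≤ ‖z‖ ∧ chain β p 1 z = chain β q 1 x) :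
    Subordinate p q := by
  by_contra hnot
  obtain ⟨z, ζ, m, hlt, hζ, hpq, hm, hder⟩ := exists_contact_of_not_subordinate hp hq.1 h0 hnot
  obtain ⟨x, hx, hxz⟩ := hsub z (mem_disk.mpr (hlt.trans (mem_disk.mp hζ)))
  have hxlt : ‖x‖ < ‖ζ‖ := hx.trans_lt hlt
  refine hq.ne_add_mul (analyticOnNhd_chain hq.1.1 1)
    (fun z hz => hq.re_deriv_chain_pos hre zero_le_one hz) hζ hxlt.le
    (fun h => hxlt.ne (by rw [h])) (sub_nonneg.mpr hm) ?_
  -- At the contact, the operator of p at z becomes L_m(ζ) = L_1(ζ) + (m - 1) ζ q'(ζ).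
  rw [← hxz, ← chain_eq_add, chain, chain, hpq, hder]
  simp

theorem ConvexUnivalent.superordinate_of_chain (hq : ConvexUnivalent q)
    (hre : ∀ z ∈ disk, 0 < (β + 2 * q z).re) {p : ℂ → ℂ} (hp : Univalent p)
    (hinj : InjOn (chain β p 1) disk) (h0 : q 0 = p 0)
    (hsub : ∀ z ∈ disk, ∃ x, ‖x‖ ≤ ‖z‖ ∧ chain β q 1 z = chain β p 1 x) :
    Subordinate q p := by
  by_contra hnot
  obtain ⟨z, ζ, m, hlt, hζ, hqp, hm, hder⟩ := exists_contact_of_not_subordinate hq.1.1 hp h0 hnot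
  have hm0 : (m : ℂ) ≠ 0 := by
    have : m ≠ 0 := by linarith
    exact_mod_cast this
  -- The parameter is 1/m because ζ p'(ζ) = z q'(z)/m, so that L_{1/m}(z) is the operator of p at ζ.
  obtain ⟨y, hy, hyz⟩ := hq.chain_mem_image hre (inv_nonneg.mpr (zero_le_one.trans hm))
    (inv_le_one_of_one_le₀ hm) (mem_disk.mp hζ) hlt
  have hyn : ‖y‖ < ‖ζ‖ := by simpa using hy
  obtain ⟨x, hx, hxy⟩ := hsub y (mem_disk.mpr (hyn.trans (mem_disk.mp hζ)))
  have hxn : ‖x‖ < ‖ζ‖ := hx.trans_lt hyn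
  have heq : chain β p 1 x = chain β p 1 ζ := by
    rw [← hxy, hyz, chain, chain, hqp, hder]
    push_cast
    rw [inv_mul_cancel_left₀ hm0, one_mul]
  have := hinj (mem_disk.mpr (hxn.trans (mem_disk.mp hζ))) hζ heq
  exact hxn.ne (by rw [this])

end

/-! ### Transfer to `hFun`. -/

theorem hFun_eq_mul_chain {α : ℂ} (hα : α ≠ 0) (q : ℂ → ℂ) (z : ℂ) :
    hFun α q z = α * chain ((1 - α) / α) q 1 z := by
  simp only [hFun, chain, Complex.ofReal_one]
  field_simp

theorem chain_eq_of_hFun_eq {α : ℂ} (hα : α ≠ 0) {a b : ℂ → ℂ} {x y : ℂ}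
    (h : hFun α a x = hFun α b y) :
    chain ((1 - α) / α) a 1 x = chain ((1 - α) / α) b 1 y := by
  rw [hFun_eq_mul_chain hα, hFun_eq_mul_chain hα] at h
  exact mul_left_cancel₀ hα h

section

variable {α : ℂ} {q p : ℂ → ℂ}

theorem ConvexUnivalent.univalent_hFun (hα : α ≠ 0) (hq : ConvexUnivalent q)
    (hre : ∀ z ∈ disk, 0 < ((1 - α) / α + 2 * q z).re) : Univalent (hFun α q) := by
  have h := hq.univalent_chain hre zero_le_one
  have h1 : hFun α q = fun z => α * chain ((1 - α) / α) q 1 z :=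
    funext (hFun_eq_mul_chain hα q)
  rw [h1]
  exact ⟨fun z hz => analyticAt_const.mul (h.1 z hz),
    fun x hx y hy hxy => h.2 hx hy (mul_left_cancel₀ hα hxy)⟩

theorem ConvexUnivalent.subordinate_of_hFun (hα : α ≠ 0) (hq : ConvexUnivalent q)
    (hre : ∀ z ∈ disk, 0 < ((1 - α) / α + 2 * q z).re) (hp : AnalyticOnNhd ℂ p disk)
    (h0 : p 0 = q 0) (hsub : Subordinate (hFun α p) (hFun α q)) : Subordinate p q :=
  hq.subordinate_of_chain hre hp h0 fun _ hz =>
    let ⟨x, hx, h⟩ := hsub.exists_norm_le hz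
    ⟨x, hx, chain_eq_of_hFun_eq hα h⟩

theorem ConvexUnivalent.superordinate_of_hFun (hα : α ≠ 0) (hq : ConvexUnivalent q)
    (hre : ∀ z ∈ disk, 0 < ((1 - α) / α + 2 * q z).re) (hp : Univalent p)
    (hinj : InjOn (hFun α p) disk) (h0 : q 0 = p 0)
    (hsub : Subordinate (hFun α q) (hFun α p)) : Subordinate q p :=
  hq.superordinate_of_chain hre hp
    (fun x hx y hy hxy => hinj hx hy
      (by rw [hFun_eq_mul_chain hα, hFun_eq_mul_chain hα, hxy])) h0 fun _ hz =>
    let ⟨x, hx, h⟩ := hsub.exists_norm_le hz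
    ⟨x, hx, chain_eq_of_hFun_eq hα h⟩

end

theorem diffOp_eq_hFun (α : ℂ) (p : ℂ → ℂ) :
    diffOp (fun r s _ _ => α * r ^ 2 + (1 - α) * r + α * s) p = hFun α p := by
  funext z
  simp only [diffOp, hFun]
  ring

theorem Subordinate.refl (f : ℂ → ℂ) : Subordinate f f :=
  ⟨id, analyticOnNhd_id, rfl, fun _ hz => mem_disk.mp hz, fun _ _ => rfl⟩

theorem mem_classH_one {p : ℂ → ℂ} (hp : AnalyticOnNhd ℂ p disk) {a : ℂ} (h0 : p 0 = a) :
    p ∈ ClassH a 1 :=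
  ⟨hp, h0, fun k hk hk1 => absurd hk1 (by omega)⟩

theorem univalent_of_classQ {p : ℂ → ℂ} (hp : AnalyticOnNhd ℂ p disk) (hQ : p ∈ ClassQ) :
    Univalent p := by
  obtain ⟨F, hF, -, hinj, -⟩ := hQ
  have hsub : disk ⊆ Metric.closedBall (0 : ℂ) 1 \ exceptionalSet p := fun z hz =>
    ⟨Metric.ball_subset_closedBall hz, fun h => (mem_disk.mp hz).ne h.1⟩
  refine ⟨hp, fun x hx y hy hxy => hinj (hsub hx) (hsub hy) ?_⟩
  rw [hF hx, hF hy, hxy]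

/-! ### The quotient z f'/Φ(f). -/

theorem analyticAt_phi {f Φ : ℂ → ℂ} (hΦ : AdmissiblePhi f Φ) {z : ℂ}
    (hz : z ∈ disk) : AnalyticAt ℂ Φ (f z) := by
  obtain ⟨⟨U, -, -, hfU, hU⟩, -⟩ := hΦ
  exact hU _ (hfU (mem_image_of_mem f hz))

/-- If `z f' / Φ(f)` has no poles then `f` vanishes at the origin only. -/
theorem ne_zero_of_analyticOnNhd_phiQuot {f Φ : ℂ → ℂ} (hf : f ∈ ClassA)
    (hΦ : AdmissiblePhi f Φ) (hp : AnalyticOnNhd ℂ (phiQuot f Φ) disk) {z : ℂ} (hz : z ∈ disk)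
    (hz0 : z ≠ 0) : f z ≠ 0 := by
  intro hfz
  have hfa := hf.1 z hz
  have hΦ0 := analyticAt_phi hΦ hz
  rw [hfz] at hΦ0
  -- A local zero of infinite order would make f vanish identically, against f'(0) = 1.
  have hnot : ¬ ∀ᶠ y in 𝓝 z, f y = 0 := by
    intro h
    have h1 : EqOn f 0 disk := hf.1.eqOn_zero_of_preconnected_of_eventuallyEq_zero
      (convex_ball (0 : ℂ) 1).isPreconnected hz h
    have h2 : deriv f 0 = 0 := by
      rw [(h1.eventuallyEq_of_mem (isOpen_disk.mem_nhds zero_mem_disk)).deriv_eq]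
      simp
    exact zero_ne_one (h2.symm.trans hf.2.2)
  have hne : ∀ᶠ y in 𝓝[≠] z, f y ≠ 0 :=
    hfa.eventually_eq_zero_or_eventually_ne_zero.resolve_left hnot
  have hord1 : ((1 : ℕ) : ℕ∞) ≤ analyticOrderAt Φ 0 := by
    rw [Nat.cast_one, Order.one_le_iff_ne_zero, Ne, hΦ0.analyticOrderAt_eq_zero]
    simpa using hΦ.2.1
  obtain ⟨g, hg, hgeq⟩ := (natCast_le_analyticOrderAt hΦ0).mp hord1
  have hgf : AnalyticAt ℂ (fun y => g (f y)) z := by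
    rw [← hfz] at hg
    exact hg.fun_comp hfa
  have hΦf : ∀ᶠ y in 𝓝 z, Φ (f y) = f y * g (f y) := by
    have := hfa.continuousAt.tendsto
    rw [hfz] at this
    filter_upwards [this.eventually hgeq] with y hy
    simpa using hy
  have hL : AnalyticAt ℂ (fun y => f y * (phiQuot f Φ y * g (f y))) z :=
    hfa.mul ((hp z hz).mul hgf)
  have hR : AnalyticAt ℂ (fun y => y * deriv f y) z := analyticAt_id.mul hfa.deriv
  have heq : ∀ᶠ y in 𝓝[≠] z, f y * (phiQuot f Φ y * g (f y)) = y * deriv f y := by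
    filter_upwards [hne, hΦf.filter_mono nhdsWithin_le_nhds,
      (isOpen_disk.eventually_mem hz).filter_mono nhdsWithin_le_nhds,
      (eventually_ne_nhds hz0).filter_mono nhdsWithin_le_nhds] with y h1 h2 h3 h4
    have h5 : Φ (f y) ≠ 0 := hΦ.2.2.2 _ ⟨mem_image_of_mem f h3, h1⟩
    rw [phiQuot, if_neg h4, mul_left_comm, ← h2, div_mul_cancel₀ _ h5]
  -- Near z the identity z f' = f · (p · g(f)) extends across the puncture, whatever value division
  -- by zero assigns at z.
  have heq' := (hL.frequently_eq_iff_eventually_eq hR).mp heq.frequently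
  have h1 := analyticOrderAt_congr heq'
  have h2 : analyticOrderAt (fun y => f y * (phiQuot f Φ y * g (f y))) z =
      analyticOrderAt f z + analyticOrderAt (fun y => phiQuot f Φ y * g (f y)) z :=
    analyticOrderAt_mul hfa ((hp z hz).mul hgf)
  have h3 : analyticOrderAt (fun y => y * deriv f y) z =
      analyticOrderAt (fun y : ℂ => y) z + analyticOrderAt (deriv f) z :=
    analyticOrderAt_mul analyticAt_id hfa.deriv
  have h4 : analyticOrderAt (fun y : ℂ => y) z = 0 :=
    (analyticAt_id.analyticOrderAt_eq_zero).mpr hz0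
  have h5 := hfa.analyticOrderAt_deriv_add_one
  simp only [hfz, sub_zero] at h5
  have h6 : analyticOrderAt f z ≠ ⊤ := by rwa [Ne, analyticOrderAt_eq_top]
  rw [h2, h3, h4, zero_add] at h1
  -- Yet the order of f' at a zero of f is one less than that of f.
  have h7 : analyticOrderAt f z ≤ analyticOrderAt (deriv f) z := h1 ▸ le_self_add
  have h8 : analyticOrderAt (deriv f) z ≠ ⊤ := fun h => h6 (by rw [← h5, h]; rfl)
  rw [← h5] at h7
  exact absurd (ENat.add_one_le_iff h8 |>.mp h7) (lt_irrefl _)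

/-- The quotient rule for z f'/Φ(f); only Φ(f(z)) ≠ 0 is needed off the origin, so zeros of f' are
harmless, and at 0 both sides equal 1. -/
theorem phiExpr_eq_hFun {f Φ : ℂ → ℂ} (α : ℂ) (hf : f ∈ ClassA) (hΦ : AdmissiblePhi f Φ)
    (hp : AnalyticOnNhd ℂ (phiQuot f Φ) disk) {z : ℂ} (hz : z ∈ disk) :
    phiExpr α f Φ z = hFun α (phiQuot f Φ) z := by
  rcases eq_or_ne z 0 with rfl | hz0
  · simp [phiExpr, hFun, phiQuot]
  have hfz := ne_zero_of_analyticOnNhd_phiQuot hf hΦ hp hz hz0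
  have hΦz : Φ (f z) ≠ 0 := hΦ.2.2.2 _ ⟨mem_image_of_mem f hz, hfz⟩
  have hfa := hf.1 z hz
  have hΦf : DifferentiableAt ℂ (fun u => Φ (f u)) z :=
    (analyticAt_phi hΦ hz).differentiableAt.comp z hfa.differentiableAt
  have hev : phiQuot f Φ =ᶠ[𝓝 z] fun y => y * deriv f y / Φ (f y) := by
    filter_upwards [eventually_ne_nhds hz0] with y hy
    rw [phiQuot, if_neg hy]
  have hd : deriv (phiQuot f Φ) z = ((1 * deriv f z + z * deriv (deriv f) z) * Φ (f z) -
      z * deriv f z * deriv (fun u => Φ (f u)) z) / Φ (f z) ^ 2 := by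
    rw [hev.deriv_eq]
    exact (((hasDerivAt_id z).mul hfa.deriv.differentiableAt.hasDerivAt).div
      hΦf.hasDerivAt hΦz).deriv
  rw [hFun, hd, phiExpr, if_neg hz0, phiQuot, if_neg hz0]
  field_simp
  ring

theorem Subordinate.congr {a b c d : ℂ → ℂ} (h : Subordinate a b) (hac : EqOn a c disk)
    (hbd : EqOn b d disk) : Subordinate c d := by
  obtain ⟨w, hw, hw0, hw1, hab⟩ := h
  refine ⟨w, hw, hw0, hw1, fun z hz => ?_⟩
  rw [← hac hz, hab z hz, hbd (mem_disk.mpr (hw1 z hz))]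

end PhiLike

theorem theorem5 (α : ℂ) (hα : α ≠ 0) (q₁ q₂ : ℂ → ℂ)
    (hq₁ : ConvexUnivalent q₁) (hq₂ : ConvexUnivalent q₂)
    (hq₁0 : q₁ 0 = 1) (hq₂0 : q₂ 0 = 1)
    (hre₁ : ∀ z ∈ disk, 0 < ((1 - α) / α + 2 * q₁ z).re)
    (hre₂ : ∀ z ∈ disk, 0 < ((1 - α) / α + 2 * q₂ z).re) :
    (∀ f Φ : ℂ → ℂ, f ∈ ClassA → AdmissiblePhi f Φ →
      phiQuot f Φ ∈ ClassH 1 1 ∩ ClassQ →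
      Univalent (phiExpr α f Φ) →
      Subordinate (hFun α q₁) (phiExpr α f Φ) →
      Subordinate (phiExpr α f Φ) (hFun α q₂) →
      Subordinate q₁ (phiQuot f Φ) ∧ Subordinate (phiQuot f Φ) q₂) ∧
    IsBestSubordinant (fun r s _ _ => α * r ^ 2 + (1 - α) * r + α * s) 1 (hFun α q₁) q₁ ∧
    IsBestDominant (fun r s _ _ => α * r ^ 2 + (1 - α) * r + α * s) 1 (hFun α q₂) q₂ := by
  have hh₁ := hq₁.univalent_hFun hα hre₁
  have hh₂ := hq₂.univalent_hFun hα hre₂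
  refine ⟨fun f Φ hf hΦ hp huniv h₁ h₂ => ?_, ⟨hq₁.1, ⟨hq₁.1.1, fun p hp => ?_⟩, fun r hr => ?_⟩,
    ⟨hq₂.1, fun p hp => ?_⟩, fun r hr => ?_⟩
  · have hpa := hp.1.1
    have heq : EqOn (phiExpr α f Φ) (hFun α (phiQuot f Φ)) disk := fun z hz =>
      phiExpr_eq_hFun α hf hΦ hpa hz
    exact ⟨hq₁.superordinate_of_hFun hα hre₁ (univalent_of_classQ hpa hp.2)
        (huniv.2.congr heq) (hq₁0.trans hp.1.2.1.symm) (h₁.congr (eqOn_refl _ _) heq),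
      hq₂.subordinate_of_hFun hα hre₂ hpa (hp.1.2.1.trans hq₂0.symm)
        (h₂.congr heq (eqOn_refl _ _))⟩
  · obtain ⟨hpH, hpu, hpd, hsub⟩ := hp
    rw [diffOp_eq_hFun] at hpd hsub
    exact hq₁.superordinate_of_hFun hα hre₁ hpu hpd.2 (hq₁0.trans hpH.2.1.symm) hsub
  -- A subordinant lies below every solution, in particular below q₁.
  · refine hr.2 q₁ ⟨mem_classH_one hq₁.1.1 hq₁0, hq₁.1, ?_, ?_⟩
    · rwa [diffOp_eq_hFun]
    · rw [diffOp_eq_hFun]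
      exact Subordinate.refl _
  · obtain ⟨hpH, -, hsub⟩ := hp
    rw [diffOp_eq_hFun] at hsub
    exact hq₂.subordinate_of_hFun hα hre₂ hpH.1 (hpH.2.1.trans hq₂0.symm) hsub
  · refine hr.2 q₂ ⟨mem_classH_one hq₂.1.1 hq₂0, ?_, ?_⟩
    · rw [diffOp_eq_hFun]
      exact hh₂.1
    · rw [diffOp_eq_hFun]
      exact Subordinate.refl _
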